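/- Let $F$ be a field and let $K,K'$ be nonempty finite geometric simplicial complexes in $\mathbb R^3$. For $\omega\in S^2$ put $h_\omega(x)=\langle x,\omega\rangle$, and filter $K$ by the full subcomplexes spanned by the vertices with $h_\omega\le a$, $a\in\mathbb R$. Let $\mathrm{Dgm}_k(h^K_\omega)$ be the degree-$k$ persistence diagram over $F$ of this filtration (a finite multiset of points $(b,d)$ with $b\in\mathbb R$, $b<d\le\infty$, where $d=\infty$ for essential classes). Let $d_B$ be the bottleneck distance: the infimum over partial matchings of the maximum of the $L_\infty$-distances of matched points and of the numbers $\tfrac12(d-b)$ for unmatched points $(b,d)$; two points $(b,\infty)$, $(b',\infty)$ have distance $|b-b'|$, and matching $(b,\infty)$ with a finite point or leaving it unmatched costs $\infty$. Put $$H(\omega)=\max_{k=0,1,2} d_B\bigl(\mathrm{Dgm}_k(h^K_\omega),\mathrm{Dgm}_k(h^{K'}_\omega)\bigr),\qquad d_\infty=\sup_{\omega\in S^2}H(\omega).$$ For a simplex $\alpha$ of $K$ or $K'$ let $I_\alpha(\omega)=\max_{v\in\alpha}\langle v,\omega\rangle$, the maximum being over the vertices of $\alpha$. For two distinct elements $\alpha,\sigma$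 of the disjoint union of the sets of simplices of $K$ and of $K'$, the difference surface $\Delta_{\alpha,\sigma}:S^2\to\mathbb R$ is $|I_\alpha-I_\sigma|$ if $\alpha,\sigma$ come from different complexes and $\tfrac12|I_\alpha-I_\sigma|$ if they come from the same complex. The intersection of two difference surfaces $f,g$ is the boundary in $S^2$ of the set $\{f=g\}$: interiors of regions where $f$ and $g$ coincide do not count as intersections, but boundaries of such regions do. **Theorem (Events for $d_\infty$ in $\mathbb R^3$).** Suppose that $d_\infty<\infty$. Then $H$ attains the value $d_\infty$ on $S^2$, and for every $\omega^*\in S^2$ with $H(\omega^*)=d_\infty$ at least one of the following holds. 1. There is a difference surface $f$ with $f(\omega^*)=d_\infty$ that has a local maximum at $\omega^*$. 2. There are two difference surfaces $f,g$ with $f(\omega^*)=g(\omega^*)=d_\infty$ such that $\omega^*$ is a non-isolated point of the intersection of $f$ and $g$ and the restriction of $f$ to $\{f=g\}$ (in particular, to the intersection curve) has a local maximum at $\omega^*$. 3. There are three difference surfaces $f,g,h$ with $f(\omega^*)=g(\omega^*)=h(\omega^*)=d_\infty$ such that $\omega^*$ lies on the intersection of each two of them. -/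

import Mathlib

open scoped ENNReal Topology Filter

noncomputable section

namespace PHT

/-- Euclidean 3-space. -/
abbrev E3 : Type := EuclideanSpace ℝ (Fin 3)

/-- The sphere of directions. -/
abbrev S2 : Type := Metric.sphere (0 : E3) 1

/-- The height of a point in a direction. -/
def height (ω : S2) (x : E3) : ℝ := inner ℝ x (ω : E3)

/-! ### Simplicial chains and persistent homology groups -/

/-- The lexicographic order on points, used only to orient simplices by ordering their vertices. -/
def lexLT (x y : E3) : Prop := toLex x.ofLp < toLex y.ofLp

/-- A finite set of vertices stands for the simplex it spans, oriented by `lexLT`; the coefficient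
of a vertex `v` of `σ` is `(-1) ^ i`, where `i` is the position (from `0`) of `v` in `σ`. -/
def incidenceSign (F : Type*) [Field F] (σ : Finset E3) (v : E3) : F :=
  open Classical in (-1) ^ (σ.filter (fun w => lexLT w v)).card

/-- The simplicial boundary operator with coefficients in `F` (not augmented: the boundary of
a vertex is zero), on the space freely generated by all finite sets of points. -/
def boundary (F : Type*) [Field F] : (Finset E3 →₀ F) →ₗ[F] (Finset E3 →₀ F) :=
  Finsupp.lsum F fun σ => LinearMap.toSpanSingleton F (Finset E3 →₀ F)
    (open Classical in
      if 2 ≤ σ.card then ∑ v ∈ σ, Finsupp.single (σ.erase v) (incidenceSign F σ v) else 0)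

/-- The `k`-chains of a subcomplex `L` (a set of simplices). -/
def chains (F : Type*) [Field F] (k : ℕ) (L : Set (Finset E3)) : Submodule F (Finset E3 →₀ F) :=
  Finsupp.supported F F {σ | σ ∈ L ∧ σ.card = k + 1}

/-- The `k`-cycles of `L`. -/
def cycles (F : Type*) [Field F] (k : ℕ) (L : Set (Finset E3)) : Submodule F (Finset E3 →₀ F) :=
  chains F k L ⊓ LinearMap.ker (boundary F)

/-- The `k`-boundaries of `L`. -/
def boundaries (F : Type*) [Field F] (k : ℕ) (L : Set (Finset E3)) :
    Submodule F (Finset E3 →₀ F) :=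
  (chains F (k + 1) L).map (boundary F)

/-- For subcomplexes `L ⊆ M`: the dimension of the image of `H_k(L) → H_k(M)`, that is, of the
space `Z_k(L) / (Z_k(L) ∩ B_k(M))` of classes of cycles of `L` modulo boundaries of `M`. -/
def persistentBetti (F : Type*) [Field F] (k : ℕ) (L M : Set (Finset E3)) : ℕ :=
  Module.finrank F ((cycles F k L).map (boundaries F k M).mkQ)

/-! ### The height filtration -/

variable (K K' : Geometry.SimplicialComplex ℝ E3)

/-- The sublevel complex: the full subcomplex on the vertices of height at most `a`. -/
def sublevel (ω : S2) (a : ℝ) : Set (Finset E3) := {σ ∈ K.faces | ∀ v ∈ σ, height ω v ≤ a}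

/-- The full subcomplex on the vertices of height less than `a`; by finiteness, this is the
sublevel complex just before the value `a`. -/
def strictSublevel (ω : S2) (a : ℝ) : Set (Finset E3) := {σ ∈ K.faces | ∀ v ∈ σ, height ω v < a}

/-- The insertion function `I_α(ω)`, the maximal height of a vertex of the simplex `α`. -/
def insertion (α : K.faces) (ω : S2) : ℝ :=
  α.1.sup' (K.nonempty_of_mem_faces α.2) (height ω)

/-- The finitely many values at which simplices enter the height filtration. -/
def heightValues [Finite K.faces] (ω : S2) : Finset ℝ :=
  (Set.finite_range fun α : K.faces => insertion K α ω).toFinset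

/-- The number of degree `k` classes that are born at `b` and die at `d`, for `b < d`. -/
def mult (F : Type*) [Field F] (k : ℕ) (ω : S2) (b d : ℝ) : ℕ :=
  (persistentBetti F k (sublevel K ω b) (strictSublevel K ω d)
      - persistentBetti F k (sublevel K ω b) (sublevel K ω d))
    - (persistentBetti F k (strictSublevel K ω b) (strictSublevel K ω d)
      - persistentBetti F k (strictSublevel K ω b) (sublevel K ω d))

/-- The number of degree `k` classes that are born at `b` and never die. -/
def multTop (F : Type*) [Field F] (k : ℕ) (ω : S2) (b : ℝ) : ℕ :=
  persistentBetti F k (sublevel K ω b) K.faces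
    - persistentBetti F k (strictSublevel K ω b) K.faces

/-- The degree `k` persistence diagram of the height filtration in direction `ω`: the finite
multiset of pairs (birth, death) with birth < death, where the death is `⊤` for essential
classes. -/
def dgm (F : Type*) [Field F] [Finite K.faces] (k : ℕ) (ω : S2) : Multiset (ℝ × WithTop ℝ) :=
  ∑ b ∈ heightValues K ω,
    (Multiset.replicate (multTop K F k ω b) (b, ⊤) +
      ∑ d ∈ (heightValues K ω).filter (fun d => b < d),
        Multiset.replicate (mult K F k ω b d) (b, (d : WithTop ℝ)))

/-! ### The bottleneck distance -/

/-- The distance of two deaths; `⊤` is at distance `0` from itself and `∞` from real numbers. -/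
def deathDist : WithTop ℝ → WithTop ℝ → ℝ≥0∞
  | some d, some d' => ENNReal.ofReal |d - d'|
  | none, none => 0
  | some _, none => ∞
  | none, some _ => ∞

/-- The `L_∞` distance of two diagram points. -/
def pointDist (x y : ℝ × WithTop ℝ) : ℝ≥0∞ :=
  max (ENNReal.ofReal |x.1 - y.1|) (deathDist x.2 y.2)

/-- The cost of leaving a diagram point unmatched: half of its persistence. -/
def diagDist : ℝ × WithTop ℝ → ℝ≥0∞
  | (b, some d) => ENNReal.ofReal (|d - b| / 2)
  | (_, none) => ∞

/-- `M`, a multiset of pairs, is a partial matching of the multisets `X` and `Y`. -/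
def IsPartialMatching (X Y : Multiset (ℝ × WithTop ℝ))
    (M : Multiset ((ℝ × WithTop ℝ) × (ℝ × WithTop ℝ))) : Prop :=
  M.map Prod.fst ≤ X ∧ M.map Prod.snd ≤ Y

/-- The cost of a partial matching: the maximum of the distances of matched points and of the
distances of the unmatched points of `X` and `Y` to the diagonal. -/
def matchingCost (X Y : Multiset (ℝ × WithTop ℝ))
    (M : Multiset ((ℝ × WithTop ℝ) × (ℝ × WithTop ℝ))) : ℝ≥0∞ :=
  open Classical in
  (M.map fun p => pointDist p.1 p.2).sup
    ⊔ ((X - M.map Prod.fst).map diagDist).sup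
    ⊔ ((Y - M.map Prod.snd).map diagDist).sup

/-- The bottleneck distance of two persistence diagrams. -/
def bottleneck (X Y : Multiset (ℝ × WithTop ℝ)) : ℝ≥0∞ :=
  ⨅ (M) (_ : IsPartialMatching X Y M), matchingCost X Y M

/-- The bottleneck distance `H(ω)` of the (graded) persistence diagrams of `K` and `K'` in
direction `ω`: the maximum over the degrees `0, 1, 2`. -/
def bottleneckAt (F : Type*) [Field F] [Finite K.faces] [Finite K'.faces] (ω : S2) : ℝ≥0∞ :=
  (Finset.range 3).sup fun k => bottleneck (dgm K F k ω) (dgm K' F k ω)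

/-- The maximum bottleneck distance `d_∞` of the persistent homology transforms. -/
def dInf (F : Type*) [Field F] [Finite K.faces] [Finite K'.faces] : ℝ≥0∞ :=
  ⨆ ω : S2, bottleneckAt K K' F ω

/-! ### Difference surfaces -/

/-- The difference function `Δ_{α,σ}` of two simplices of the disjoint union of `K` and `K'`. -/
def diffFun : K.faces ⊕ K'.faces → K.faces ⊕ K'.faces → S2 → ℝ
  | .inl α, .inr σ => fun ω => |insertion K α ω - insertion K' σ ω|
  | .inr α, .inl σ => fun ω => |insertion K' α ω - insertion K σ ω|
  | .inl α, .inl σ => fun ω => |insertion K α ω - insertion K σ ω| / 2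
  | .inr α, .inr σ => fun ω => |insertion K' α ω - insertion K' σ ω| / 2

/-- The difference surfaces: the functions `Δ_{α,σ}` of distinct simplices `α` and `σ`. -/
def diffSurfaces : Set (S2 → ℝ) := {f | ∃ α σ, α ≠ σ ∧ f = diffFun K K' α σ}

/-- The locus on which two surfaces agree. -/
def agreement (f g : S2 → ℝ) : Set S2 := {ω | f ω = g ω}

/-- The intersection of two surfaces, where open regions in which they coincide do not count but
the boundaries of such regions do. -/
def intersection (f g : S2 → ℝ) : Set S2 := frontier (agreement f g)

end PHT

end

/-!
The bottleneck distance `H ω` in direction `ω` is a continuous function of `ω`, and its value in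
every direction is the value of one of the finitely many difference surfaces. The three cases
then follow from a purely topological fact about continuous selections of finitely many continuous
functions.

*Local structure of a maximum* (`selection_max_trichotomy`). Let `w` be a maximum of `H`, and sort
the surfaces with value `H w` at `w` by their germs at `w`. Near `w`, the value of `H` is the
value of one of these surfaces. If there is only one germ, it is the germ of `H` and has a local
maximum. Distinct germs with the same value at `w` intersect at `w`, so three germs give a triple
intersection. If there are exactly two germs `f` and `g`, then `H = f = g` where they agree, so `f`
restricted to `{f = g}` is maximal at `w`; and if `w` is isolated in the intersection, then on a
connected punctured neighbourhood `f` and `g` are nowhere equal, so `H` is equal to the same one of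
them throughout, which therefore has a local maximum at `w`. Since the argument compares germs
only, the piecewise linear structure of the surfaces plays no role. On the sphere, connected
punctured neighbourhoods come from stereographic projection.

*Values* (`exists_diffSurface_eq`). There are finitely many partial matchings of two diagrams, so
the distance is attained, and its value, if not zero, is the cost of one pair or of one unmatched
point; the coordinates of diagram points are values of insertion functions. If the distance is
zero, an essential class in degree zero, which exists because a vertex is never a boundary, is
matched to one with the same birth, and the corresponding difference surface vanishes.

*Continuity* (`continuous_bottleneckAt`). By the triangle inequality for the bottleneck distance, it
is enough that the diagram moves continuously. Close to a direction `ω₀`, the order in which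
simplices enter refines the order in direction `ω₀`, so there is a monotone map `π` that collapses
the values in direction `ω` to those in direction `ω₀` and moves each of them only slightly
(`IsCollapse`). The multiplicities are second differences of the ranks of persistent homology,
and such differences telescope along the fibres of `π`; hence `π` carries the diagram in direction
`ω` to the diagram in direction `ω₀` together with points on the diagonal
(`IsCollapse.map_dgm`), and the two diagrams are close (`bottleneck_map_filter_le`).
-/

namespace PHT

open Filter Set

/-! ### Maxima of continuous selections -/

section Trichotomy

variable {X : Type*} [TopologicalSpace X]

/-- Two continuous functions that agree at `w` but not near `w` intersect at `w`. -/
theorem mem_frontier_setOf_eq {f g : X → ℝ} {w : X} (hw : f w = g w) (h : ¬ f =ᶠ[𝓝 w] g) :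
    w ∈ frontier {x | f x = g x} :=
  ⟨subset_closure hw, fun hi => h (mem_interior_iff_mem_nhds.1 hi)⟩

/-- If `H` selects, at each point, the value of one of two functions `f`, `g`, and is maximal at an
isolated point `w` of their intersection, then one of the two has a local maximum at `w`: punctured
neighbourhoods of `w` are connected and `f`, `g` do not meet there, so `H` cannot switch between
them. -/
theorem isLocalMax_or_isLocalMax_of_not_accPt {H f g : X → ℝ} {w : X}
    (hH : Continuous H) (hf : Continuous f) (hg : Continuous g)
    (hconn : ∀ N ∈ 𝓝[≠] w, ∃ P ⊆ N, P ∈ 𝓝[≠] w ∧ IsPreconnected P)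
    (hmax : ∀ x, H x ≤ H w) (hfw : f w = H w) (hgw : g w = H w)
    (hsel : ∀ᶠ x in 𝓝 w, H x = f x ∨ H x = g x) (hfg : ¬ f =ᶠ[𝓝 w] g)
    (hacc : ¬ AccPt w (𝓟 (frontier {x | f x = g x}))) :
    IsLocalMax f w ∨ IsLocalMax g w := by
  have hacc' : ∀ᶠ x in 𝓝[≠] w, x ∉ frontier {x | f x = g x} := by
    rw [accPt_iff_frequently_nhdsNE] at hacc
    exact not_frequently.1 hacc
  obtain ⟨P, hPN, hPw, hPc⟩ := hconn _ (hacc'.and (hsel.filter_mono nhdsWithin_le_nhds))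
  -- what holds on `P` and at `w` holds near `w`
  have punct : ∀ {p : X → Prop}, (∀ x ∈ P, p x) → p w → ∀ᶠ x in 𝓝 w, p x := by
    intro p hp hpw
    have h1 : ∀ᶠ x in 𝓝[≠] w, p x := mem_of_superset hPw hp
    rw [eventually_nhdsWithin_iff] at h1
    filter_upwards [h1] with x hx
    by_cases hxw : x = w
    · rwa [hxw]
    · exact hx hxw
  have hne : ∀ x ∈ P, f x ≠ g x := by
    intro x hx hxe
    have hcover : P ⊆ interior {x | f x = g x} ∪ (closure {x | f x = g x})ᶜ := fun y hy =>
      or_iff_not_imp_right.2 fun hyc => by_contra fun hyi => (hPN hy).1 ⟨not_not.1 hyc, hyi⟩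
    have hsub := hPc.subset_left_of_subset_union isOpen_interior isClosed_closure.isOpen_compl
      (disjoint_compl_right.mono_left (interior_subset.trans subset_closure)) hcover
      ⟨x, hx, (hcover hx).resolve_right fun hxc => hxc (subset_closure hxe)⟩
    exact hfg (punct (fun y hy => (interior_subset (hsub hy) : y ∈ {x | f x = g x}))
      (hfw.trans hgw.symm))
  by_cases hA : ∀ x ∈ P, H x = f x
  · left
    exact punct (fun x hx => by rw [← hA x hx, hfw]; exact hmax x) le_rfl
  by_cases hB : ∀ x ∈ P, H x = g x
  · right
    exact punct (fun x hx => by rw [← hB x hx, hgw]; exact hmax x) le_rfl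
  exfalso
  push Not at hA hB
  obtain ⟨x, hx, hxf⟩ := hA
  obtain ⟨y, hy, hyg⟩ := hB
  obtain ⟨z, hz, hzf, hzg⟩ := isPreconnected_closed_iff.1 hPc _ _ (isClosed_eq hH hf)
    (isClosed_eq hH hg) (fun z hz => (hPN hz).2)
    ⟨y, hy, (hPN hy).2.resolve_right hyg⟩ ⟨x, hx, (hPN hx).2.resolve_left hxf⟩
  exact hne z hz (hzf.symm.trans hzg)

/-- The local structure of a maximum of a continuous selection `H` of finitely many continuous
functions `S`. The members of `S` with the value `H w` at `w` fall into germs at `w`. If there is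
one germ, `H` has it as its own germ; three distinct germs meet pairwise at `w`; if there are
exactly two, then near `w` both are equal to `H` wherever they agree. -/
theorem selection_max_trichotomy {H : X → ℝ} {S : Set (X → ℝ)} (hS : S.Finite)
    (hSc : ∀ f ∈ S, Continuous f) (hH : Continuous H) (hsel : ∀ x, ∃ f ∈ S, H x = f x) {w : X}
    (hconn : ∀ N ∈ 𝓝[≠] w, ∃ P ⊆ N, P ∈ 𝓝[≠] w ∧ IsPreconnected P)
    (hmax : ∀ x, H x ≤ H w) :
    (∃ f ∈ S, f w = H w ∧ IsLocalMax f w) ∨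
    (∃ f ∈ S, ∃ g ∈ S, f w = H w ∧ g w = H w ∧ w ∈ frontier {x | f x = g x} ∧
      AccPt w (𝓟 (frontier {x | f x = g x})) ∧ IsLocalMaxOn f {x | f x = g x} w) ∨
    (∃ f ∈ S, ∃ g ∈ S, ∃ h ∈ S, f w = H w ∧ g w = H w ∧ h w = H w ∧
      w ∈ frontier {x | f x = g x} ∧ w ∈ frontier {x | g x = h x} ∧
      w ∈ frontier {x | f x = h x}) := by
  have hloc : ∀ᶠ x in 𝓝 w, ∃ f ∈ S, f w = H w ∧ H x = f x := by
    have : ∀ᶠ x in 𝓝 w, ∀ f ∈ S, f w ≠ H w → f x ≠ H x := by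
      rw [eventually_all_finite hS]
      intro f hf
      by_cases hfw : f w = H w
      · simp [hfw]
      · filter_upwards [((hSc f hf).continuousAt.ne_iff_eventually_ne hH.continuousAt).1 hfw]
          with x hx _ using hx
    filter_upwards [this] with x hx
    obtain ⟨f, hf, hfx⟩ := hsel x
    exact ⟨f, hf, by_contra fun hn => hx f hf hn hfx.symm, hfx⟩
  obtain ⟨f, hf, hfw'⟩ := hsel w
  have hfw := hfw'.symm
  have hgerm : ∀ {p : (X → ℝ) → Prop}, (∀ f ∈ S, f w = H w → p f) →
      ∀ᶠ x in 𝓝 w, ∃ f ∈ S, p f ∧ H x = f x := fun hp =>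
    hloc.mono fun x ⟨f, hf, hfw, hfx⟩ => ⟨f, hf, hp f hf hfw, hfx⟩
  by_cases h1 : ∀ g ∈ S, g w = H w → g =ᶠ[𝓝 w] f
  · left
    refine ⟨f, hf, hfw, ?_⟩
    have h2 : ∀ᶠ x in 𝓝 w, ∀ g ∈ S, g w = H w → g x = f x :=
      (eventually_all_finite hS).2 fun g hg => by
        by_cases hgw : g w = H w
        · exact (h1 g hg hgw).mono fun x hx _ => hx
        · simp [hgw]
    filter_upwards [hloc, h2] with x ⟨g, hg, hgw, hgx⟩ hx
    rw [← hx g hg hgw, ← hgx, hfw]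
    exact hmax x
  push Not at h1
  obtain ⟨g, hg, hgw, hgf⟩ := h1
  have hfg : ¬ f =ᶠ[𝓝 w] g := fun h => hgf h.symm
  by_cases h3 : ∃ h ∈ S, h w = H w ∧ ¬ h =ᶠ[𝓝 w] f ∧ ¬ h =ᶠ[𝓝 w] g
  · obtain ⟨h, hh, hhw, hhf, hhg⟩ := h3
    exact Or.inr (Or.inr ⟨f, hf, g, hg, h, hh, hfw, hgw, hhw,
      mem_frontier_setOf_eq (hfw.trans hgw.symm) hfg,
      mem_frontier_setOf_eq (hgw.trans hhw.symm) fun e => hhg e.symm,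
      mem_frontier_setOf_eq (hfw.trans hhw.symm) fun e => hhf e.symm⟩)
  push Not at h3
  have hsel2 : ∀ᶠ x in 𝓝 w, H x = f x ∨ H x = g x := by
    have h2 : ∀ᶠ x in 𝓝 w, ∀ h ∈ S, h w = H w → h x = f x ∨ h x = g x :=
      (eventually_all_finite hS).2 fun h hh => by
        by_cases hhw : h w = H w
        · by_cases hhf : h =ᶠ[𝓝 w] f
          · exact hhf.mono fun x hx _ => Or.inl hx
          · exact (h3 h hh hhw hhf).mono fun x hx _ => Or.inr hx
        · simp [hhw]
    filter_upwards [hloc, h2] with x ⟨h, hh, hhw, hhx⟩ hx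
    rw [hhx]
    exact hx h hh hhw
  by_cases hacc : AccPt w (𝓟 (frontier {x | f x = g x}))
  · refine Or.inr (Or.inl ⟨f, hf, g, hg, hfw, hgw,
      mem_frontier_setOf_eq (hfw.trans hgw.symm) hfg, hacc, ?_⟩)
    filter_upwards [hsel2.filter_mono nhdsWithin_le_nhds, self_mem_nhdsWithin] with x hx hxe
    have : H x = f x := hx.elim id fun h => h.trans (Eq.symm hxe)
    rw [← this, hfw]
    exact hmax x
  · rcases isLocalMax_or_isLocalMax_of_not_accPt hH (hSc f hf) (hSc g hg) hconn hmax hfw hgw hsel2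
      hfg hacc with h | h
    · exact Or.inl ⟨f, hf, hfw, h⟩
    · exact Or.inl ⟨g, hg, hgw, h⟩

end Trichotomy

/-! ### Punctured neighbourhoods in the sphere -/

/-- A punctured ball around the origin is connected in dimension at least two. -/
theorem isPreconnected_ball_diff_singleton {E : Type*} [NormedAddCommGroup E] [NormedSpace ℝ E]
    (h : 1 < Module.rank ℝ E) (r : ℝ) : IsPreconnected (Metric.ball (0 : E) r \ {0}) := by
  have : Metric.ball (0 : E) r \ {0} =
      (fun p : ℝ × E => p.1 • p.2) '' (Ioo 0 r ×ˢ Metric.sphere (0 : E) 1) := by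
    ext x
    simp only [Set.mem_sdiff, Metric.mem_ball, dist_zero_right, mem_singleton_iff, mem_image,
      mem_prod, mem_Ioo, mem_sphere_iff_norm, sub_zero, Prod.exists]
    constructor
    · rintro ⟨hx, hx0⟩
      have hn : ‖x‖ ≠ 0 := norm_ne_zero_iff.2 hx0
      exact ⟨‖x‖, ‖x‖⁻¹ • x, ⟨⟨norm_pos_iff.2 hx0, hx⟩, by simp [norm_smul, hn]⟩,
        by rw [smul_smul, mul_inv_cancel₀ hn, one_smul]⟩
    · rintro ⟨t, y, ⟨⟨ht0, htr⟩, hy⟩, rfl⟩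
      refine ⟨by rwa [norm_smul, hy, mul_one, Real.norm_of_nonneg ht0.le], ?_⟩
      exact smul_ne_zero ht0.ne' (norm_ne_zero_iff.1 (by rw [hy]; exact one_ne_zero))
  rw [this]
  exact (isPreconnected_Ioo.prod (isPreconnected_sphere h 0 1)).image _
    (continuous_fst.smul continuous_snd).continuousOn

instance : Fact (Module.finrank ℝ E3 = 2 + 1) := ⟨by simp⟩

/-- Points of the sphere have arbitrarily small connected punctured neighbourhoods, by
stereographic projection from the antipode. -/
theorem sphere_punctured_connected (w : S2) (N : Set S2) (hN : N ∈ 𝓝[≠] w) :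
    ∃ P ⊆ N, P ∈ 𝓝[≠] w ∧ IsPreconnected P := by
  let e := stereographic' 2 (-w)
  have hw : w ∈ e.source := by
    simp only [e, stereographic'_source, mem_compl_iff, mem_singleton_iff]
    exact ne_neg_of_mem_unit_sphere ℝ w
  have hew : e w = 0 :=
    (congrArg (OrthonormalBasis.fromOrthogonalSpanSingleton 2
      (ne_zero_of_mem_unit_sphere (-w))).repr (stereographic_neg_apply w)).trans (map_zero _)
  have htgt : e.target = univ := stereographic'_target _
  obtain ⟨U, hU, hUN⟩ := mem_nhdsWithin_iff_exists_mem_nhds_inter.1 hN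
  have h0 : e.symm ⁻¹' U ∈ 𝓝 (0 : EuclideanSpace ℝ (Fin 2)) := by
    have h1 := e.continuousAt_symm (x := 0) (by rw [htgt]; trivial)
    refine h1 ?_
    rw [← hew, e.left_inv hw]
    exact hU
  obtain ⟨r, hr, hrU⟩ := Metric.mem_nhds_iff.1 h0
  refine ⟨e.symm '' (Metric.ball 0 r \ {0}), ?_, ?_, ?_⟩
  · rintro _ ⟨y, ⟨hy, hy0⟩, rfl⟩
    refine hUN ⟨hrU hy, fun h => hy0 ?_⟩
    have : e (e.symm y) = y := e.right_inv (by rw [htgt]; trivial)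
    rw [mem_singleton_iff] at h
    rw [h, hew] at this
    exact this.symm
  · rw [mem_nhdsWithin_iff_exists_mem_nhds_inter]
    refine ⟨e.source ∩ e ⁻¹' Metric.ball 0 r, ?_, ?_⟩
    · refine inter_mem (e.open_source.mem_nhds hw) ((e.continuousAt hw) ?_)
      rw [hew]
      exact Metric.ball_mem_nhds _ hr
    · rintro x ⟨⟨hxs, hxr⟩, hxw⟩
      refine ⟨e x, ⟨hxr, fun h => hxw ?_⟩, e.left_inv hxs⟩
      exact e.injOn hxs hw (h.trans hew.symm)
  · refine (isPreconnected_ball_diff_singleton ?_ r).image _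
      (e.continuousOn_symm.mono (by rw [htgt]; exact subset_univ _))
    rw [← Module.finrank_eq_rank]
    norm_num

/-! ### The bottleneck distance -/

theorem deathDist_comm (x y : WithTop ℝ) : deathDist x y = deathDist y x := by
  induction x using WithTop.recTopCoe <;> induction y using WithTop.recTopCoe
  · rfl
  · rfl
  · rfl
  · exact congrArg ENNReal.ofReal (abs_sub_comm _ _)

theorem ofReal_abs_sub_le (a b c : ℝ) :
    ENNReal.ofReal |a - c| ≤ ENNReal.ofReal |a - b| + ENNReal.ofReal |b - c| := by
  rw [← ENNReal.ofReal_add (abs_nonneg _) (abs_nonneg _)]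
  exact ENNReal.ofReal_le_ofReal (abs_sub_le a b c)

theorem deathDist_triangle (x y z : WithTop ℝ) :
    deathDist x z ≤ deathDist x y + deathDist y z := by
  induction x using WithTop.recTopCoe <;> induction y using WithTop.recTopCoe <;>
    induction z using WithTop.recTopCoe
  on_goal 8 => exact ofReal_abs_sub_le _ _ _
  all_goals simp [deathDist]

theorem pointDist_comm (x y : ℝ × WithTop ℝ) : pointDist x y = pointDist y x := by
  simp only [pointDist, deathDist_comm x.2, abs_sub_comm x.1]

theorem pointDist_triangle (x y z : ℝ × WithTop ℝ) :
    pointDist x z ≤ pointDist x y + pointDist y z :=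
  max_le ((ofReal_abs_sub_le _ y.1 _).trans (add_le_add (le_max_left _ _) (le_max_left _ _)))
    ((deathDist_triangle _ y.2 _).trans (add_le_add (le_max_right _ _) (le_max_right _ _)))

theorem diagDist_le_add (x y : ℝ × WithTop ℝ) : diagDist x ≤ pointDist x y + diagDist y := by
  obtain ⟨b, d⟩ := x
  obtain ⟨b', d'⟩ := y
  induction d using WithTop.recTopCoe <;> induction d' using WithTop.recTopCoe
  on_goal 4 =>
    rename_i d d'
    have h : pointDist (b, (d : WithTop ℝ)) (b', (d' : WithTop ℝ))
        = ENNReal.ofReal (max |b - b'| |d - d'|) := (ENNReal.ofReal_max _ _).symm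
    rw [h]
    change ENNReal.ofReal (|d - b| / 2) ≤ _ + ENNReal.ofReal (|d' - b'| / 2)
    rw [← ENNReal.ofReal_add (le_max_of_le_left (abs_nonneg _)) (by positivity)]
    refine ENNReal.ofReal_le_ofReal ?_
    have h1 := le_max_left |b - b'| |d - d'|
    have h2 := le_max_right |b - b'| |d - d'|
    have h3 := abs_sub_le d d' b
    have h4 := abs_sub_le d' b' b
    rw [abs_sub_comm b' b] at h4
    linarith
  all_goals simp [diagDist, pointDist, deathDist]

/-- A partial matching of cost at most `c` exists: `X₁` and `Y₁` are the matched parts. -/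
def HasMatching (c : ℝ≥0∞) (X Y : Multiset (ℝ × WithTop ℝ)) : Prop :=
  ∃ X₁ X₂ Y₁ Y₂, X = X₁ + X₂ ∧ Y = Y₁ + Y₂ ∧ Multiset.Rel (fun x y => pointDist x y ≤ c) X₁ Y₁ ∧
    (∀ x ∈ X₂, diagDist x ≤ c) ∧ ∀ y ∈ Y₂, diagDist y ≤ c

theorem HasMatching.symm {c : ℝ≥0∞} {X Y : Multiset (ℝ × WithTop ℝ)} (h : HasMatching c X Y) :
    HasMatching c Y X := by
  obtain ⟨X₁, X₂, Y₁, Y₂, hX, hY, hr, hX₂, hY₂⟩ := h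
  refine ⟨Y₁, Y₂, X₁, X₂, hY, hX, ?_, hY₂, hX₂⟩
  rw [← Multiset.rel_flip]
  exact hr.mono fun a _ b _ h => by rwa [flip, pointDist_comm]

theorem rel_comp {α β γ : Type*} {r : α → β → Prop} {s : β → γ → Prop} {X : Multiset α}
    {Y : Multiset β} {Z : Multiset γ} (h : Multiset.Rel r X Y) (h' : Multiset.Rel s Y Z) :
    Multiset.Rel (fun x z => ∃ y, r x y ∧ s y z) X Z := by
  induction h generalizing Z with
  | zero => rw [Multiset.rel_zero_left.1 h']; exact .zero
  | cons hab _ ih =>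
    obtain ⟨c, Z', hbc, hZ', rfl⟩ := Multiset.rel_cons_left.1 h'
    exact .cons ⟨_, hab, hbc⟩ (ih hZ')

/-- Two decompositions of a multiset have a common refinement. -/
theorem exists_add_refinement {α : Type*} {A B C D : Multiset α} (h : A + B = C + D) :
    ∃ P Q R S, A = P + Q ∧ B = R + S ∧ C = P + R ∧ D = Q + S := by
  classical
  have hc : ∀ x, A.count x + B.count x = C.count x + D.count x := fun x => by
    rw [← Multiset.count_add, h, Multiset.count_add]
  refine ⟨A ∩ C, A - C, C - A, B - (C - A), ?_, ?_, ?_, ?_⟩ <;>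
  · ext x
    have := hc x
    simp only [Multiset.count_add, Multiset.count_inter, Multiset.count_sub]
    omega

theorem forall_diagDist_le_of_rel {a b : ℝ≥0∞} {X Y : Multiset (ℝ × WithTop ℝ)}
    (h : Multiset.Rel (fun x y => pointDist x y ≤ a) X Y) (hY : ∀ y ∈ Y, diagDist y ≤ b) :
    ∀ x ∈ X, diagDist x ≤ a + b := fun x hx => by
  obtain ⟨y, hy, hxy⟩ := Multiset.exists_mem_of_rel_of_mem h hx
  exact (diagDist_le_add x y).trans (add_le_add hxy (hY y hy))

theorem HasMatching.trans {a b : ℝ≥0∞} {X Y Z : Multiset (ℝ × WithTop ℝ)}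
    (h : HasMatching a X Y) (h' : HasMatching b Y Z) : HasMatching (a + b) X Z := by
  obtain ⟨X₁, X₂, Y₁, Y₂, rfl, hY, hr, hX₂, hY₂⟩ := h
  obtain ⟨Y₁', Y₂', Z₁, Z₂, hY', rfl, hr', hY₂', hZ₂⟩ := h'
  -- `P` is the part of `Y` that is matched on both sides
  obtain ⟨P, Q, R, S, rfl, rfl, rfl, rfl⟩ := exists_add_refinement (hY.symm.trans hY')
  obtain ⟨XP, XQ, hXP, hXQ, rfl⟩ := Multiset.rel_add_right.1 hr
  obtain ⟨ZP, ZR, hZP, hZR, rfl⟩ := Multiset.rel_add_left.1 hr'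
  refine ⟨XP, XQ + X₂, ZP, ZR + Z₂, by rw [add_assoc], by rw [add_assoc], ?_, ?_, ?_⟩
  · refine (rel_comp hXP hZP).mono ?_
    rintro x _ z _ ⟨y, hxy, hyz⟩
    exact (pointDist_triangle x y z).trans (add_le_add hxy hyz)
  · intro x hx
    rcases Multiset.mem_add.1 hx with hx | hx
    · exact forall_diagDist_le_of_rel hXQ (fun y hy => hY₂' y (by simp [hy])) x hx
    · exact (hX₂ x hx).trans le_self_add
  · intro z hz
    rcases Multiset.mem_add.1 hz with hz | hz
    · rw [add_comm a b]
      refine forall_diagDist_le_of_rel (Y := R) ?_ (fun y hy => hY₂ y (by simp [hy])) z hz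
      rw [← Multiset.rel_flip]
      exact hZR.mono fun _ _ _ _ h => by rwa [flip, pointDist_comm]
    · exact (hZ₂ z hz).trans le_add_self

theorem finite_setOf_isPartialMatching (X Y : Multiset (ℝ × WithTop ℝ)) :
    {M | IsPartialMatching X Y M}.Finite := by
  classical
  refine (finite_Iic (X.card • (X ×ˢ Y))).subset fun M hM => ?_
  rw [mem_Iic, Multiset.le_iff_count]
  intro p
  rw [Multiset.count_nsmul]
  by_cases hp : p ∈ M
  · have h1 : M.count p ≤ X.card :=
      (Multiset.count_le_card _ _).trans (by simpa using Multiset.card_le_card hM.1)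
    have h2 : 0 < (X ×ˢ Y).count p := Multiset.count_pos.2 (Multiset.mem_product.2
      ⟨Multiset.mem_of_le hM.1 (Multiset.mem_map_of_mem _ hp),
        Multiset.mem_of_le hM.2 (Multiset.mem_map_of_mem _ hp)⟩)
    exact h1.trans (Nat.le_mul_of_pos_right _ h2)
  · simp [Multiset.count_eq_zero_of_notMem hp]

/-- There are finitely many partial matchings, so an optimal one exists. -/
theorem exists_bottleneck_eq (X Y : Multiset (ℝ × WithTop ℝ)) :
    ∃ M, IsPartialMatching X Y M ∧ bottleneck X Y = matchingCost X Y M := by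
  obtain ⟨M, hM, hmin⟩ := exists_min_image _ (matchingCost X Y)
    (finite_setOf_isPartialMatching X Y) ⟨0, by simp [IsPartialMatching]⟩
  exact ⟨M, hM, le_antisymm (iInf₂_le M hM) (le_iInf₂ hmin)⟩

theorem matchingCost_le_iff {X Y : Multiset (ℝ × WithTop ℝ)}
    {M : Multiset ((ℝ × WithTop ℝ) × (ℝ × WithTop ℝ))} {c : ℝ≥0∞} :
    matchingCost X Y M ≤ c ↔ (∀ p ∈ M, pointDist p.1 p.2 ≤ c) ∧
      (∀ x ∈ X - M.map Prod.fst, diagDist x ≤ c) ∧ ∀ y ∈ Y - M.map Prod.snd, diagDist y ≤ c := by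
  classical
  simp only [matchingCost, sup_le_iff, Multiset.sup_le, Multiset.forall_mem_map_iff, and_assoc]

theorem exists_map_of_rel {α β : Type*} {r : α → β → Prop} {X : Multiset α} {Y : Multiset β}
    (h : Multiset.Rel r X Y) :
    ∃ M : Multiset (α × β), M.map Prod.fst = X ∧ M.map Prod.snd = Y ∧ ∀ p ∈ M, r p.1 p.2 := by
  induction h with
  | zero => exact ⟨0, by simp⟩
  | @cons a b _ _ hab _ ih =>
    obtain ⟨M, h1, h2, h3⟩ := ih
    exact ⟨(a, b) ::ₘ M, by simp [h1], by simp [h2], by simpa using ⟨hab, fun a b => h3 (a, b)⟩⟩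

theorem bottleneck_le_iff {c : ℝ≥0∞} {X Y : Multiset (ℝ × WithTop ℝ)} :
    bottleneck X Y ≤ c ↔ HasMatching c X Y := by
  constructor
  · intro h
    obtain ⟨M, hM, hc⟩ := exists_bottleneck_eq X Y
    rw [hc, matchingCost_le_iff] at h
    refine ⟨M.map Prod.fst, X - M.map Prod.fst, M.map Prod.snd, Y - M.map Prod.snd,
      (add_tsub_cancel_of_le hM.1).symm, (add_tsub_cancel_of_le hM.2).symm, ?_, h.2⟩
    exact Multiset.rel_map.2 (Multiset.rel_refl_of_refl_on h.1)
  · rintro ⟨X₁, X₂, Y₁, Y₂, rfl, rfl, hr, hX, hY⟩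
    obtain ⟨M, rfl, rfl, h3⟩ := exists_map_of_rel hr
    refine (iInf₂_le M ⟨le_self_add, le_self_add⟩).trans (matchingCost_le_iff.2 ⟨h3, ?_, ?_⟩)
    · rwa [add_tsub_cancel_left]
    · rwa [add_tsub_cancel_left]

theorem bottleneck_comm (X Y : Multiset (ℝ × WithTop ℝ)) : bottleneck X Y = bottleneck Y X :=
  le_antisymm (bottleneck_le_iff.2 (bottleneck_le_iff.1 le_rfl).symm)
    (bottleneck_le_iff.2 (bottleneck_le_iff.1 le_rfl).symm)

theorem bottleneck_triangle (X Y Z : Multiset (ℝ × WithTop ℝ)) :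
    bottleneck X Z ≤ bottleneck X Y + bottleneck Y Z :=
  bottleneck_le_iff.2 ((bottleneck_le_iff.1 le_rfl).trans (bottleneck_le_iff.1 le_rfl))

theorem sup_mem_or_eq_bot {α : Type*} [LinearOrder α] [OrderBot α] (s : Multiset α) :
    s.sup ∈ s ∨ s.sup = ⊥ := by
  induction s using Multiset.induction with
  | empty => simp
  | cons a s ih =>
    rw [Multiset.sup_cons]
    rcases le_total a s.sup with h | h
    · rw [sup_eq_right.2 h]
      exact ih.imp_left Multiset.mem_cons_of_mem
    · rw [sup_eq_left.2 h]
      exact Or.inl (Multiset.mem_cons_self a s)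

/-- A nonzero bottleneck distance is the distance of two diagram points, or the distance of a
diagram point to the diagonal. -/
theorem bottleneck_value (X Y : Multiset (ℝ × WithTop ℝ)) :
    bottleneck X Y = 0 ∨ (∃ x ∈ X, ∃ y ∈ Y, bottleneck X Y = pointDist x y) ∨
      (∃ x ∈ X, bottleneck X Y = diagDist x) ∨ ∃ y ∈ Y, bottleneck X Y = diagDist y := by
  classical
  obtain ⟨M, hM, hc⟩ := exists_bottleneck_eq X Y
  rw [hc]
  have key : ∀ {α : Type} (s : Multiset α) (φ : α → ℝ≥0∞),
      matchingCost X Y M = (s.map φ).sup → matchingCost X Y M = 0 ∨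
        ∃ x ∈ s, matchingCost X Y M = φ x := by
    intro α s φ h
    rcases sup_mem_or_eq_bot (s.map φ) with h' | h'
    · obtain ⟨x, hx, hxe⟩ := Multiset.mem_map.1 h'
      exact Or.inr ⟨x, hx, h.trans hxe.symm⟩
    · exact Or.inl (h.trans h')
  have hdef : matchingCost X Y M = (M.map fun p => pointDist p.1 p.2).sup
    ⊔ ((X - M.map Prod.fst).map diagDist).sup ⊔ ((Y - M.map Prod.snd).map diagDist).sup := by
    rw [matchingCost]
  rcases max_choice ((M.map fun p => pointDist p.1 p.2).sup
    ⊔ ((X - M.map Prod.fst).map diagDist).sup) ((Y - M.map Prod.snd).map diagDist).sup with h | h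
  · rcases max_choice (M.map fun p => pointDist p.1 p.2).sup
      ((X - M.map Prod.fst).map diagDist).sup with h' | h'
    · refine (key M _ (hdef.trans (h.trans h'))).imp_right fun ⟨p, hp, e⟩ => Or.inl
        ⟨p.1, Multiset.mem_of_le hM.1 (Multiset.mem_map_of_mem _ hp), p.2,
          Multiset.mem_of_le hM.2 (Multiset.mem_map_of_mem _ hp), e⟩
    · exact (key _ _ (hdef.trans (h.trans h'))).imp_right fun ⟨p, hp, e⟩ => Or.inr (Or.inl
        ⟨p, Multiset.mem_of_le tsub_le_self hp, e⟩)
  · exact (key _ _ (hdef.trans h)).imp_right fun ⟨p, hp, e⟩ => Or.inr (Or.inr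
        ⟨p, Multiset.mem_of_le tsub_le_self hp, e⟩)

/-- At bottleneck distance zero, every essential point is matched to an essential point with the
same birth. -/
theorem exists_top_mem_of_bottleneck_eq_zero {X Y : Multiset (ℝ × WithTop ℝ)}
    (h : bottleneck X Y = 0) {b : ℝ} (hb : (b, ⊤) ∈ X) : (b, ⊤) ∈ Y := by
  obtain ⟨X₁, X₂, Y₁, Y₂, rfl, rfl, hr, hX, -⟩ := bottleneck_le_iff.1 h.le
  rcases Multiset.mem_add.1 hb with hb | hb
  · obtain ⟨⟨b', d'⟩, hy, hxy⟩ := Multiset.exists_mem_of_rel_of_mem hr hb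
    have h1 : |b - b'| ≤ 0 := ENNReal.ofReal_eq_zero.1 (le_zero_iff.1 ((le_max_left _ _).trans hxy))
    have h2 : deathDist ⊤ d' ≤ 0 := (le_max_right _ _).trans hxy
    induction d' using WithTop.recTopCoe with
    | top =>
      rw [sub_eq_zero.1 (abs_nonpos_iff.1 h1)]
      exact Multiset.mem_add.2 (Or.inl hy)
    | coe d' => exact absurd h2 (by simp [deathDist])
  · exact absurd (hX _ hb) (by simp [diagDist])

/-- If a map moves every coordinate by at most `ε`, then a diagram is within `ε` of its image from
which the points on the diagonal are removed: the points that the map sends to the diagonal are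
themselves within `ε` of it. -/
theorem bottleneck_map_filter_le {X : Multiset (ℝ × WithTop ℝ)} {π : ℝ → ℝ} {ε : ℝ}
    (hb : ∀ x ∈ X, |π x.1 - x.1| ≤ ε) (hd : ∀ x ∈ X, ∀ d : ℝ, x.2 = d → |π d - d| ≤ ε) :
    bottleneck X ((X.map (Prod.map π (WithTop.map π))).filter fun x => (x.1 : WithTop ℝ) ≠ x.2) ≤
      ENNReal.ofReal ε := by
  classical
  rw [bottleneck_le_iff, Multiset.filter_map]
  refine ⟨X.filter ((fun x => (x.1 : WithTop ℝ) ≠ x.2) ∘ Prod.map π (WithTop.map π)),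
    X.filter (fun x => ¬ ((fun x => (x.1 : WithTop ℝ) ≠ x.2) ∘ Prod.map π (WithTop.map π)) x),
    _, 0, (Multiset.filter_add_not _ _).symm, (add_zero _).symm, ?_, ?_, by simp⟩
  · rw [Multiset.rel_map_right]
    refine Multiset.rel_refl_of_refl_on fun x hx => ?_
    have hx := (Multiset.mem_filter.1 hx).1
    have h1 := hb x hx
    have h2 := hd x hx
    obtain ⟨b, d⟩ := x
    refine max_le (ENNReal.ofReal_le_ofReal ?_) ?_
    · rw [abs_sub_comm]
      exact h1
    · induction d using WithTop.recTopCoe with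
      | top => exact zero_le
      | coe d =>
        refine ENNReal.ofReal_le_ofReal ?_
        rw [abs_sub_comm]
        exact h2 d rfl
  · intro x hx
    obtain ⟨hx, he⟩ := Multiset.mem_filter.1 hx
    have h1 := hb x hx
    have h2 := hd x hx
    obtain ⟨b, d⟩ := x
    simp only [Function.comp_apply, ne_eq, not_not, Prod.map_apply] at he
    induction d using WithTop.recTopCoe with
    | top => simp at he
    | coe d =>
      refine ENNReal.ofReal_le_ofReal ?_
      have he : π b = π d := by simpa using he
      have h3 := h2 d rfl
      have h4 := abs_sub_le d (π d) b
      simp only [he] at h1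
      rw [abs_sub_comm d (π d)] at h4
      linarith

/-! ### Ranks of persistent homology -/

section Betti

variable (F : Type*) [Field F] (k : ℕ)

theorem chains_mono {L M : Set (Finset E3)} (h : L ⊆ M) : chains F k L ≤ chains F k M :=
  Finsupp.supported_mono fun _ hσ => ⟨h hσ.1, hσ.2⟩

theorem cycles_mono {L M : Set (Finset E3)} (h : L ⊆ M) : cycles F k L ≤ cycles F k M :=
  inf_le_inf_right _ (chains_mono F k h)

theorem boundaries_mono {L M : Set (Finset E3)} (h : L ⊆ M) :
    boundaries F k L ≤ boundaries F k M :=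
  Submodule.map_mono (chains_mono F (k + 1) h)

theorem finiteDimensional_cycles {L : Set (Finset E3)} (hL : L.Finite) :
    FiniteDimensional F (cycles F k L) := by
  have : Finite {σ | σ ∈ L ∧ σ.card = k + 1} := (hL.subset fun _ h => h.1).to_subtype
  have : FiniteDimensional F (chains F k L) :=
    Module.Finite.equiv (Finsupp.supportedEquivFinsupp {σ | σ ∈ L ∧ σ.card = k + 1}).symm
  exact Submodule.finiteDimensional_of_le (inf_le_left : cycles F k L ≤ chains F k L)

theorem finrank_map_mkQ_add_finrank_inf {V : Type*} [AddCommGroup V] [Module F V]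
    (Z B : Submodule F V) [FiniteDimensional F Z] :
    Module.finrank F (Z.map B.mkQ) + Module.finrank F (Z ⊓ B : Submodule F V) =
      Module.finrank F Z := by
  have h := (B.mkQ.domRestrict Z).finrank_range_add_finrank_ker
  rw [LinearMap.range_domRestrict, LinearMap.ker_domRestrict, Submodule.ker_mkQ] at h
  rw [← h, ← Submodule.finrank_map_subtype_eq Z (B.comap Z.subtype),
    Submodule.map_comap_subtype]

variable {F k}

theorem persistentBetti_add {L : Set (Finset E3)} (hL : L.Finite) (M : Set (Finset E3)) :
    persistentBetti F k L M +
      Module.finrank F (cycles F k L ⊓ boundaries F k M : Submodule F (Finset E3 →₀ F)) =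
      Module.finrank F (cycles F k L) := by
  have := finiteDimensional_cycles F k hL
  exact finrank_map_mkQ_add_finrank_inf F _ _

theorem persistentBetti_mono_left {L L' : Set (Finset E3)} (h : L ⊆ L') (hL' : L'.Finite)
    (M : Set (Finset E3)) : persistentBetti F k L M ≤ persistentBetti F k L' M := by
  have := finiteDimensional_cycles F k hL'
  exact Submodule.finrank_mono (Submodule.map_mono (cycles_mono F k h))

theorem persistentBetti_anti_right {L M M' : Set (Finset E3)} (h : M ⊆ M') (hL : L.Finite) :
    persistentBetti F k L M' ≤ persistentBetti F k L M := by
  have := finiteDimensional_cycles F k hL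
  have : FiniteDimensional F
      (cycles F k L ⊓ boundaries F k M' : Submodule F (Finset E3 →₀ F)) :=
    Submodule.finiteDimensional_of_le (inf_le_left : _ ≤ cycles F k L)
  have h1 := persistentBetti_add (F := F) (k := k) hL M
  have h2 := persistentBetti_add (F := F) (k := k) hL M'
  have h3 := Submodule.finrank_mono (inf_le_inf_left (cycles F k L) (boundaries_mono F k h))
  omega

/-- The number of classes of `L` that die between `M` and `M'` grows with `L`. -/
theorem persistentBetti_exchange {L L' M M' : Set (Finset E3)} (h : L ⊆ L') (hL' : L'.Finite)
    (hM : M ⊆ M') :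
    persistentBetti F k L M + persistentBetti F k L' M' ≤
      persistentBetti F k L' M + persistentBetti F k L M' := by
  have hL := hL'.subset h
  have := finiteDimensional_cycles F k hL
  have := finiteDimensional_cycles F k hL'
  have h1 := persistentBetti_add (F := F) (k := k) hL M
  have h2 := persistentBetti_add (F := F) (k := k) hL M'
  have h3 := persistentBetti_add (F := F) (k := k) hL' M
  have h4 := persistentBetti_add (F := F) (k := k) hL' M'
  have hZ := cycles_mono F k h
  have hB := boundaries_mono F k hM
  have i1 : FiniteDimensional F
      (cycles F k L ⊓ boundaries F k M' : Submodule F (Finset E3 →₀ F)) :=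
    Submodule.finiteDimensional_of_le (inf_le_left : _ ≤ cycles F k L)
  have i2 : FiniteDimensional F
      (cycles F k L' ⊓ boundaries F k M : Submodule F (Finset E3 →₀ F)) :=
    Submodule.finiteDimensional_of_le (inf_le_left : _ ≤ cycles F k L')
  have i3 : FiniteDimensional F
      (cycles F k L' ⊓ boundaries F k M' : Submodule F (Finset E3 →₀ F)) :=
    Submodule.finiteDimensional_of_le (inf_le_left : _ ≤ cycles F k L')
  have h5 := Submodule.finrank_sup_add_finrank_inf_eq
    (cycles F k L ⊓ boundaries F k M') (cycles F k L' ⊓ boundaries F k M)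
  have h6 : (cycles F k L ⊓ boundaries F k M') ⊓ (cycles F k L' ⊓ boundaries F k M) =
      cycles F k L ⊓ boundaries F k M := by
    rw [inf_inf_inf_comm, inf_eq_left.2 hZ, inf_eq_right.2 hB]
  have h7 := Submodule.finrank_mono (sup_le (inf_le_inf_right (boundaries F k M') hZ)
    (inf_le_inf_left (cycles F k L') hB))
  rw [h6] at h5
  omega

end Betti

/-! ### Essential classes in degree zero -/

section Essential

variable (F : Type*) [Field F]

/-- The sum of the coefficients of a chain. -/
noncomputable def augmentation : (Finset E3 →₀ F) →ₗ[F] F := Finsupp.linearCombination F fun _ => 1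

theorem lexLT_total {x y : E3} (h : x ≠ y) : lexLT x y ∨ lexLT y x := by
  refine lt_or_gt_of_ne fun e => h ?_
  have : x.ofLp = y.ofLp := toLex_inj.1 e
  ext i
  exact congrFun this i

theorem lexLT_asymm {x y : E3} (h : lexLT x y) : ¬ lexLT y x := lt_asymm h

theorem incidenceSign_pair {x y : E3} (h : lexLT x y) :
    incidenceSign F {x, y} x = 1 ∧ incidenceSign F {x, y} y = -1 := by
  classical
  have hx : ¬ lexLT x x := lt_irrefl _
  have hy : ¬ lexLT y y := lt_irrefl _
  have hyx := lexLT_asymm h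
  simp [incidenceSign, Finset.filter_insert, Finset.filter_singleton, hx, hy, h, hyx]

theorem augmentation_boundary_single {σ : Finset E3} (hσ : σ.card = 2) (c : F) :
    augmentation F (boundary F (Finsupp.single σ c)) = 0 := by
  classical
  have key : ∀ x y : E3, lexLT x y → σ = {x, y} →
      augmentation F (boundary F (Finsupp.single σ c)) = 0 := by
    rintro x y hxy rfl
    have hne : x ≠ y := fun e => lt_irrefl (toLex y.ofLp) (by rw [e] at hxy; exact hxy)
    obtain ⟨h1, h2⟩ := incidenceSign_pair F hxy
    simp [boundary, augmentation, hσ, Finset.sum_pair hne, h1, h2]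
  obtain ⟨x, y, hne, rfl⟩ := Finset.card_eq_two.1 hσ
  rcases lexLT_total hne with h | h
  · exact key x y h rfl
  · exact key y x h (Finset.pair_comm x y)

theorem augmentation_eq_zero_of_mem_boundaries {M : Set (Finset E3)} {z : Finset E3 →₀ F}
    (hz : z ∈ boundaries F 0 M) : augmentation F z = 0 := by
  obtain ⟨c, hc, rfl⟩ := hz
  suffices h : chains F (0 + 1) M ≤ LinearMap.ker ((augmentation F).comp (boundary F)) from h hc
  rw [chains, Finsupp.supported_eq_span_single, Submodule.span_le]
  rintro _ ⟨σ, hσ, rfl⟩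
  exact augmentation_boundary_single F hσ.2 1

/-- A vertex represents a nonzero class in degree zero. -/
theorem persistentBetti_zero_pos {L M : Set (Finset E3)} (hL : L.Finite) {v : E3}
    (hv : {v} ∈ L) : 0 < persistentBetti F 0 L M := by
  have := finiteDimensional_cycles F 0 hL
  rw [persistentBetti, Module.finrank_pos_iff_exists_ne_zero]
  have hz : Finsupp.single {v} (1 : F) ∈ cycles F 0 L :=
    ⟨Finsupp.single_mem_supported _ _ ⟨hv, by simp⟩, by simp [boundary]⟩
  refine ⟨⟨_, Submodule.mem_map_of_mem hz⟩, fun h => ?_⟩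
  have h := (Submodule.Quotient.mk_eq_zero _).1 (congrArg Subtype.val h)
  simpa [augmentation] using augmentation_eq_zero_of_mem_boundaries F h

theorem persistentBetti_empty (k : ℕ) (M : Set (Finset E3)) : persistentBetti F k ∅ M = 0 := by
  have : cycles F k ∅ = ⊥ := by
    rw [eq_bot_iff]
    refine inf_le_left.trans (le_of_eq ?_)
    simp [chains, Finsupp.supported_empty]
  rw [persistentBetti, this, Submodule.map_bot, finrank_bot]

end Essential

/-! ### The height filtration and its diagram -/

section Filtration

variable (K : Geometry.SimplicialComplex ℝ E3)

theorem insertion_le_iff (α : K.faces) (ω : S2) (a : ℝ) :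
    insertion K α ω ≤ a ↔ ∀ v ∈ α.1, height ω v ≤ a := Finset.sup'_le_iff _ _

theorem insertion_lt_iff (α : K.faces) (ω : S2) (a : ℝ) :
    insertion K α ω < a ↔ ∀ v ∈ α.1, height ω v < a := Finset.sup'_lt_iff _

theorem continuous_insertion (α : K.faces) : Continuous (insertion K α) :=
  Continuous.finset_sup'_apply _ fun _ _ => continuous_const.inner continuous_subtype_val

/-- The simplices that enter the height filtration at a value in `A`. -/
def entering (ω : S2) (A : Set ℝ) : Set (Finset E3) :=
  {σ | ∃ h : σ ∈ K.faces, insertion K ⟨σ, h⟩ ω ∈ A}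

theorem entering_Iic (ω : S2) (a : ℝ) : entering K ω (Iic a) = sublevel K ω a := by
  ext σ
  simp [entering, sublevel, insertion_le_iff]

theorem entering_Iio (ω : S2) (a : ℝ) : entering K ω (Iio a) = strictSublevel K ω a := by
  ext σ
  simp [entering, strictSublevel, insertion_lt_iff]

theorem sublevel_subset (ω : S2) (a : ℝ) : sublevel K ω a ⊆ K.faces := fun _ h => h.1

theorem strictSublevel_subset_sublevel (ω : S2) (a : ℝ) :
    strictSublevel K ω a ⊆ sublevel K ω a := fun _ h => ⟨h.1, fun v hv => (h.2 v hv).le⟩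

variable [Finite K.faces]

theorem mem_heightValues {ω : S2} {a : ℝ} :
    a ∈ heightValues K ω ↔ ∃ α : K.faces, insertion K α ω = a := by
  simp [heightValues]

theorem finite_sublevel (ω : S2) (a : ℝ) : (sublevel K ω a).Finite :=
  (Set.toFinite K.faces).subset (sublevel_subset K ω a)

section Multiplicity

variable (F : Type*) [Field F] (k : ℕ)

theorem multTop_cast (ω : S2) (b : ℝ) :
    (multTop K F k ω b : ℤ) = persistentBetti F k (sublevel K ω b) K.faces
      - persistentBetti F k (strictSublevel K ω b) K.faces := by
  rw [multTop, Nat.cast_sub]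
  exact persistentBetti_mono_left (strictSublevel_subset_sublevel K ω b) (finite_sublevel K ω b) _

/-- The multiplicity is an alternating sum of ranks: its subtractions do not truncate, because ranks
are monotone and the number of dying classes grows with the subcomplex. -/
theorem mult_cast (ω : S2) {b d : ℝ} :
    (mult K F k ω b d : ℤ) =
      ((persistentBetti F k (sublevel K ω b) (strictSublevel K ω d) : ℤ)
        - persistentBetti F k (sublevel K ω b) (sublevel K ω d))
      - ((persistentBetti F k (strictSublevel K ω b) (strictSublevel K ω d) : ℤ)
        - persistentBetti F k (strictSublevel K ω b) (sublevel K ω d)) := by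
  have hb := strictSublevel_subset_sublevel K ω b
  have hd := strictSublevel_subset_sublevel K ω d
  have hf := finite_sublevel K ω b
  have h1 := persistentBetti_anti_right (F := F) (k := k) hd hf
  have h2 := persistentBetti_anti_right (F := F) (k := k) hd (hf.subset hb)
  have h3 := persistentBetti_exchange (F := F) (k := k) hb hf hd
  rw [mult]
  omega

end Multiplicity

theorem mem_dgm {F : Type*} [Field F] {k : ℕ} {ω : S2} {x : ℝ × WithTop ℝ} :
    x ∈ dgm K F k ω ↔ ∃ b ∈ heightValues K ω, (multTop K F k ω b ≠ 0 ∧ x = (b, ⊤)) ∨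
      ∃ d ∈ heightValues K ω, b < d ∧ mult K F k ω b d ≠ 0 ∧ x = (b, (d : WithTop ℝ)) := by
  simp only [dgm, Multiset.mem_sum, Multiset.mem_add, Multiset.mem_replicate, Finset.mem_filter,
    and_assoc]

/-- Over a set of values that is closed downwards, the increments of a function of the filtration
telescope. -/
theorem sum_increments_of_lower (ω : S2) (g : Set (Finset E3) → ℤ) (A : Finset ℝ)
    (hA : A ⊆ heightValues K ω) (hlow : ∀ a ∈ A, ∀ b ∈ heightValues K ω, b ≤ a → b ∈ A) :
    ∑ b ∈ A, (g (sublevel K ω b) - g (strictSublevel K ω b)) = g (entering K ω A) - g ∅ := by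
  induction A using Finset.induction_on_max with
  | empty => simp [entering]
  | insert m A hm ih =>
    have hmA : m ∉ A := fun h => lt_irrefl _ (hm m h)
    have hval : ∀ α : K.faces, insertion K α ω ∈ heightValues K ω := fun α =>
      (mem_heightValues K).2 ⟨α, rfl⟩
    have h1 : entering K ω (insert m A : Finset ℝ) = sublevel K ω m := by
      rw [← entering_Iic]
      ext σ
      refine exists_congr fun hσ => ⟨fun h => ?_, fun h => ?_⟩
      · rcases Finset.mem_insert.1 h with h | h
        · exact h.le
        · exact (hm _ h).le
      · exact hlow m (Finset.mem_insert_self _ _) _ (hval _) h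
    have h2 : entering K ω A = strictSublevel K ω m := by
      rw [← entering_Iio]
      ext σ
      refine exists_congr fun hσ => ⟨fun h => hm _ h, fun h => ?_⟩
      exact Finset.mem_of_mem_insert_of_ne
        (hlow m (Finset.mem_insert_self _ _) _ (hval _) (le_of_lt h)) (ne_of_lt h)
    rw [Finset.sum_insert hmA, ih ((Finset.subset_insert _ _).trans hA), h1, h2]
    · ring
    · intro a ha b hb hba
      exact Finset.mem_of_mem_insert_of_ne (hlow a (Finset.mem_insert_of_mem ha) b hb hba)
        (hba.trans_lt (hm a ha)).ne

/-! ### Comparison of nearby directions -/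

/-- `π` sends the value at which a simplex enters in direction `ω` to the value at which it enters
in direction `ω₀`, and this is monotone. Such a `π` exists when `ω` is close to `ω₀`: moving away
from `ω₀` can only split values. -/
structure IsCollapse (ω ω₀ : S2) (π : ℝ → ℝ) : Prop where
  apply_insertion : ∀ α : K.faces, π (insertion K α ω) = insertion K α ω₀
  monotone : ∀ a ∈ heightValues K ω, ∀ b ∈ heightValues K ω, a ≤ b → π a ≤ π b

variable {K}

theorem IsCollapse.mem_heightValues {ω ω₀ : S2} {π : ℝ → ℝ} (h : IsCollapse K ω ω₀ π) {a : ℝ}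
    (ha : a ∈ heightValues K ω) : π a ∈ heightValues K ω₀ := by
  obtain ⟨α, rfl⟩ := (PHT.mem_heightValues K).1 ha
  exact (PHT.mem_heightValues K).2 ⟨α, (h.apply_insertion α).symm⟩

theorem IsCollapse.entering_filter {ω ω₀ : S2} {π : ℝ → ℝ} (h : IsCollapse K ω ω₀ π)
    (p : ℝ → Prop) [DecidablePred p] :
    entering K ω ((heightValues K ω).filter fun a => p (π a)) = entering K ω₀ {a | p a} := by
  ext σ
  refine exists_congr fun hσ => ?_
  simp only [Finset.coe_filter, mem_ofPred_eq, h.apply_insertion, and_iff_right_iff_imp]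
  exact fun _ => (PHT.mem_heightValues K).2 ⟨_, rfl⟩

/-- The increments over the values that collapse to `c` add up to the increment at `c`. -/
theorem IsCollapse.sum_increments {ω ω₀ : S2} {π : ℝ → ℝ} (h : IsCollapse K ω ω₀ π)
    (g : Set (Finset E3) → ℤ) (c : ℝ) :
    ∑ b ∈ heightValues K ω with π b = c, (g (sublevel K ω b) - g (strictSublevel K ω b)) =
      g (sublevel K ω₀ c) - g (strictSublevel K ω₀ c) := by
  have hle := sum_increments_of_lower K ω g ((heightValues K ω).filter fun a => π a ≤ c)
    (Finset.filter_subset _ _) fun a ha b hb hba => by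
      rw [Finset.mem_filter] at ha ⊢
      exact ⟨hb, (h.monotone b hb a ha.1 hba).trans ha.2⟩
  have hlt := sum_increments_of_lower K ω g ((heightValues K ω).filter fun a => π a < c)
    (Finset.filter_subset _ _) fun a ha b hb hba => by
      rw [Finset.mem_filter] at ha ⊢
      exact ⟨hb, (h.monotone b hb a ha.1 hba).trans_lt ha.2⟩
  rw [h.entering_filter (· ≤ c)] at hle
  rw [h.entering_filter (· < c)] at hlt
  change _ = g (entering K ω₀ (Iic c)) - _ at hle
  change _ = g (entering K ω₀ (Iio c)) - _ at hlt
  rw [entering_Iic] at hle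
  rw [entering_Iio] at hlt
  have hsplit : (heightValues K ω).filter (fun a => π a ≤ c) =
      (heightValues K ω).filter (fun a => π a = c) ∪
        (heightValues K ω).filter fun a => π a < c := by
    rw [← Finset.filter_or]
    exact Finset.filter_congr fun a _ => le_iff_eq_or_lt
  rw [hsplit, Finset.sum_union (Finset.disjoint_filter.2 fun a _ h1 h2 => h2.ne h1), hlt] at hle
  linarith

variable (F : Type*) [Field F] (k : ℕ)

theorem IsCollapse.sum_multTop {ω ω₀ : S2} {π : ℝ → ℝ} (h : IsCollapse K ω ω₀ π) (c : ℝ) :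
    ∑ b ∈ heightValues K ω with π b = c, multTop K F k ω b = multTop K F k ω₀ c := by
  have := h.sum_increments (fun L => persistentBetti F k L K.faces) c
  zify
  simpa only [multTop_cast] using this

theorem IsCollapse.sum_mult {ω ω₀ : S2} {π : ℝ → ℝ} (h : IsCollapse K ω ω₀ π) (c e : ℝ) :
    ∑ b ∈ heightValues K ω with π b = c, ∑ d ∈ heightValues K ω with π d = e, mult K F k ω b d =
      mult K F k ω₀ c e := by
  have hd := fun L => h.sum_increments (fun M => persistentBetti F k L M) e
  have hb := h.sum_increments (fun L => (persistentBetti F k L (strictSublevel K ω₀ e) : ℤ)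
    - persistentBetti F k L (sublevel K ω₀ e)) c
  zify
  simp only [mult_cast]
  rw [← hb]
  refine Finset.sum_congr rfl fun b _ => ?_
  have h1 := hd (sublevel K ω b)
  have h2 := hd (strictSublevel K ω b)
  simp only [Finset.sum_sub_distrib] at h1 h2 ⊢
  linarith

theorem sum_replicate {ι α : Type*} (s : Finset ι) (n : ι → ℕ) (x : α) :
    ∑ i ∈ s, Multiset.replicate (n i) x = Multiset.replicate (∑ i ∈ s, n i) x :=
  (map_sum (Multiset.replicateAddMonoidHom x) n s).symm

/-- A collapse of values carries the diagram in direction `ω`, up to points on the diagonal, to the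
diagram in direction `ω₀`. -/
theorem IsCollapse.map_dgm {ω ω₀ : S2} {π : ℝ → ℝ} (h : IsCollapse K ω ω₀ π) :
    ((dgm K F k ω).map (Prod.map π (WithTop.map π))).filter (fun x => (x.1 : WithTop ℝ) ≠ x.2) =
      dgm K F k ω₀ := by
  let φ : Multiset (ℝ × WithTop ℝ) →+ Multiset (ℝ × WithTop ℝ) :=
    { toFun := fun X => (X.map (Prod.map π (WithTop.map π))).filter
        fun x => (x.1 : WithTop ℝ) ≠ x.2
      map_zero' := by simp
      map_add' := fun X Y => by simp }
  have hφ₀ : ∀ X, φ X = (X.map (Prod.map π (WithTop.map π))).filter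
      fun x => (x.1 : WithTop ℝ) ≠ x.2 := fun _ => rfl
  have hφ : ∀ n b d, φ (Multiset.replicate n (b, d)) =
      if (π b : WithTop ℝ) ≠ WithTop.map π d then Multiset.replicate n (π b, WithTop.map π d)
      else 0 := by
    intro n b d
    rw [hφ₀, Multiset.map_replicate, Prod.map_apply]
    split_ifs with hc
    · rw [Multiset.filter_eq_self]
      intro x hx
      rw [Multiset.eq_of_mem_replicate hx]
      exact hc
    · rw [Multiset.filter_eq_nil]
      intro x hx
      rw [Multiset.eq_of_mem_replicate hx]
      exact hc
  have hfin : ∀ b ∈ heightValues K ω,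
      ∑ d ∈ heightValues K ω with b < d,
        φ (Multiset.replicate (mult K F k ω b d) (b, (d : WithTop ℝ))) =
      ∑ e ∈ heightValues K ω₀ with π b < e,
        Multiset.replicate (∑ d ∈ heightValues K ω with π d = e, mult K F k ω b d)
          (π b, (e : WithTop ℝ)) := by
    intro b hb
    have h1 : ∑ d ∈ heightValues K ω with b < d,
        φ (Multiset.replicate (mult K F k ω b d) (b, (d : WithTop ℝ))) =
        ∑ d ∈ heightValues K ω with π b < π d,
          Multiset.replicate (mult K F k ω b d) (π b, (π d : WithTop ℝ)) := by
      simp only [hφ, WithTop.map_coe, ne_eq, WithTop.coe_inj]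
      rw [← Finset.sum_filter, Finset.filter_filter]
      refine Finset.sum_congr (Finset.filter_congr fun d hd => ⟨fun hc => ?_, fun hc => ?_⟩)
        fun _ _ => rfl
      · exact lt_of_le_of_ne (h.monotone b hb d hd hc.1.le) hc.2
      · exact ⟨lt_of_not_ge fun hle => (h.monotone d hd b hb hle).not_gt hc, hc.ne⟩
    rw [h1, ← Finset.sum_fiberwise_of_maps_to (g := π)
      (t := (heightValues K ω₀).filter fun e => π b < e)]
    · refine Finset.sum_congr rfl fun e he => ?_
      rw [← sum_replicate, Finset.filter_filter]
      refine Finset.sum_congr (Finset.filter_congr fun d _ => ?_) fun d hd => ?_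
      · exact ⟨fun hc => hc.2, fun hc => ⟨hc ▸ (Finset.mem_filter.1 he).2, hc⟩⟩
      · rw [(Finset.mem_filter.1 hd).2]
    · intro d hd
      rw [Finset.mem_filter] at hd ⊢
      exact ⟨h.mem_heightValues hd.1, hd.2⟩
  rw [← hφ₀, dgm, map_sum, ← Finset.sum_fiberwise_of_maps_to fun b hb => h.mem_heightValues hb, dgm]
  refine Finset.sum_congr rfl fun c _ => ?_
  have h2 : ∀ b ∈ (heightValues K ω).filter (fun b => π b = c),
      φ (Multiset.replicate (multTop K F k ω b) (b, ⊤) +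
        ∑ d ∈ heightValues K ω with b < d,
          Multiset.replicate (mult K F k ω b d) (b, (d : WithTop ℝ))) =
      Multiset.replicate (multTop K F k ω b) (c, ⊤) +
        ∑ e ∈ heightValues K ω₀ with c < e,
        Multiset.replicate (∑ d ∈ heightValues K ω with π d = e, mult K F k ω b d)
          (c, (e : WithTop ℝ)) := by
    intro b hb
    obtain ⟨hbω, rfl⟩ := Finset.mem_filter.1 hb
    rw [map_add, map_sum, hfin b hbω, hφ]
    simp
  rw [Finset.sum_congr rfl h2, Finset.sum_add_distrib, sum_replicate, h.sum_multTop F k,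
    Finset.sum_comm]
  congr 1
  refine Finset.sum_congr rfl fun e _ => ?_
  rw [sum_replicate, h.sum_mult F k]

variable (K) in
theorem eventually_exists_isCollapse (ω₀ : S2) {ε : ℝ} (hε : 0 < ε) :
    ∀ᶠ ω in 𝓝 ω₀, ∃ π, IsCollapse K ω ω₀ π ∧ ∀ a ∈ heightValues K ω, |π a - a| ≤ ε := by
  have h1 : ∀ᶠ ω in 𝓝 ω₀, ∀ α : K.faces, |insertion K α ω₀ - insertion K α ω| ≤ ε := by
    rw [eventually_all]
    intro α
    filter_upwards [Metric.continuousAt_iff'.1 (continuous_insertion K α).continuousAt ε hε]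
      with ω hω
    rw [abs_sub_comm]
    exact hω.le
  have h2 : ∀ᶠ ω in 𝓝 ω₀, ∀ α β : K.faces,
      insertion K α ω ≤ insertion K β ω → insertion K α ω₀ ≤ insertion K β ω₀ := by
    rw [eventually_all]
    intro α
    rw [eventually_all]
    intro β
    by_cases hαβ : insertion K α ω₀ ≤ insertion K β ω₀
    · simp [hαβ]
    · filter_upwards [(continuous_insertion K β).continuousAt.eventually_lt
        (continuous_insertion K α).continuousAt (not_le.1 hαβ)] with ω hω h
      exact absurd h (not_le.2 hω)
  filter_upwards [h1, h2] with ω h1 h2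
  classical
  let π : ℝ → ℝ := fun a => if h : ∃ α : K.faces, insertion K α ω = a then
    insertion K h.choose ω₀ else a
  have hπ : ∀ α : K.faces, π (insertion K α ω) = insertion K α ω₀ := by
    intro α
    have h : ∃ β : K.faces, insertion K β ω = insertion K α ω := ⟨α, rfl⟩
    have : π (insertion K α ω) = insertion K h.choose ω₀ := dif_pos h
    rw [this]
    exact le_antisymm (h2 _ _ h.choose_spec.le) (h2 _ _ h.choose_spec.ge)
  refine ⟨π, ⟨hπ, ?_⟩, ?_⟩
  · intro a ha b hb hab
    obtain ⟨α, rfl⟩ := (mem_heightValues K).1 ha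
    obtain ⟨β, rfl⟩ := (mem_heightValues K).1 hb
    rw [hπ, hπ]
    exact h2 α β hab
  · intro a ha
    obtain ⟨α, rfl⟩ := (mem_heightValues K).1 ha
    rw [hπ]
    exact h1 α

variable (K) in
/-- Local stability of the diagram of the height filtration. -/
theorem eventually_bottleneck_dgm_le (ω₀ : S2) {ε : ℝ} (hε : 0 < ε) :
    ∀ᶠ ω in 𝓝 ω₀, bottleneck (dgm K F k ω) (dgm K F k ω₀) ≤ ENNReal.ofReal ε := by
  filter_upwards [eventually_exists_isCollapse K ω₀ hε] with ω ⟨π, hπ, hε⟩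
  rw [← hπ.map_dgm F k]
  refine bottleneck_map_filter_le (fun x hx => ?_) fun x hx d hd => ?_
  · obtain ⟨b, hb, ⟨-, rfl⟩ | ⟨d, -, -, -, rfl⟩⟩ := (mem_dgm K).1 hx
    · exact hε b hb
    · exact hε b hb
  · obtain ⟨b, -, ⟨-, rfl⟩ | ⟨d', hd', -, -, rfl⟩⟩ := (mem_dgm K).1 hx
    · exact absurd hd WithTop.top_ne_coe
    · rw [← WithTop.coe_inj.1 hd]
      exact hε d' hd'

end Filtration

/-! ### Continuity of the distance in the direction -/

section Main

variable (K K' : Geometry.SimplicialComplex ℝ E3) (F : Type*) [Field F]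

section Continuity

variable [Finite K.faces] [Finite K'.faces]

theorem continuous_bottleneck_dgm (k : ℕ)
    (hfin : ∀ ω, bottleneck (dgm K F k ω) (dgm K' F k ω) ≠ ∞) :
    Continuous fun ω => bottleneck (dgm K F k ω) (dgm K' F k ω) := by
  rw [continuous_iff_continuousAt]
  intro ω₀
  refine (ENNReal.tendsto_nhds (hfin ω₀)).2 fun ε hε => ?_
  obtain ⟨δ, hδ, hδε⟩ := ENNReal.exists_nnreal_pos_mul_lt (a := 2) (by simp) hε.ne'
  have hsum : ENNReal.ofReal δ + ENNReal.ofReal δ ≤ ε := by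
    rw [ENNReal.ofReal_coe_nnreal, ← mul_two]
    exact hδε.le
  filter_upwards [eventually_bottleneck_dgm_le (K := K) F k ω₀ (ε := δ) hδ,
    eventually_bottleneck_dgm_le (K := K') F k ω₀ (ε := δ) hδ] with ω h h'
  -- the distances in the two directions differ by at most the sum of the two displacements
  have key : ∀ X X₀ Y Y₀, bottleneck X X₀ ≤ ENNReal.ofReal δ →
      bottleneck Y Y₀ ≤ ENNReal.ofReal δ → bottleneck X Y ≤ bottleneck X₀ Y₀ + ε := by
    intro X X₀ Y Y₀ hX hY
    rw [bottleneck_comm] at hY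
    calc bottleneck X Y ≤ bottleneck X X₀ + (bottleneck X₀ Y₀ + bottleneck Y₀ Y) :=
          (bottleneck_triangle _ X₀ _).trans (add_le_add_right (bottleneck_triangle _ Y₀ _) _)
      _ ≤ ENNReal.ofReal δ + (bottleneck X₀ Y₀ + ENNReal.ofReal δ) := by gcongr
      _ = bottleneck X₀ Y₀ + (ENNReal.ofReal δ + ENNReal.ofReal δ) := by ring
      _ ≤ bottleneck X₀ Y₀ + ε := by gcongr
  refine ⟨tsub_le_iff_right.2 (key _ _ _ _ ?_ ?_), key _ _ _ _ h h'⟩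
  · rwa [bottleneck_comm]
  · rwa [bottleneck_comm]

theorem bottleneckAt_le_dInf (ω : S2) : bottleneckAt K K' F ω ≤ dInf K K' F :=
  le_iSup (fun ω => bottleneckAt K K' F ω) ω

theorem continuous_bottleneckAt (hfin : dInf K K' F ≠ ∞) : Continuous (bottleneckAt K K' F) := by
  refine Continuous.finset_sup_apply (s := Finset.range 3)
    (f := fun k ω => bottleneck (dgm K F k ω) (dgm K' F k ω)) fun k hk =>
      continuous_bottleneck_dgm K K' F k fun ω => ?_
  refine ne_top_of_le_ne_top hfin (le_trans ?_ (bottleneckAt_le_dInf K K' F ω))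
  exact Finset.le_sup (f := fun k => bottleneck (dgm K F k ω) (dgm K' F k ω)) hk

end Continuity

/-! ### Difference surfaces -/

section Surfaces

theorem continuous_diffFun (α σ : K.faces ⊕ K'.faces) : Continuous (diffFun K K' α σ) := by
  rcases α with α | α <;> rcases σ with σ | σ <;> unfold diffFun
  · exact ((continuous_insertion K α).sub (continuous_insertion K σ)).abs.div_const 2
  · exact ((continuous_insertion K α).sub (continuous_insertion K' σ)).abs
  · exact ((continuous_insertion K' α).sub (continuous_insertion K σ)).abs
  · exact ((continuous_insertion K' α).sub (continuous_insertion K' σ)).abs.div_const 2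

theorem diffFun_nonneg (α σ : K.faces ⊕ K'.faces) (ω : S2) : 0 ≤ diffFun K K' α σ ω := by
  rcases α with α | α <;> rcases σ with σ | σ <;> unfold diffFun <;> positivity

theorem finite_diffSurfaces [Finite K.faces] [Finite K'.faces] : (diffSurfaces K K').Finite := by
  refine (finite_range fun p : (K.faces ⊕ K'.faces) × (K.faces ⊕ K'.faces) =>
    diffFun K K' p.1 p.2).subset ?_
  rintro f ⟨α, σ, -, rfl⟩
  exact ⟨(α, σ), rfl⟩

variable {K K'}

theorem exists_diffSurface_of_mixed [Finite K.faces] [Finite K'.faces] {ω : S2} {b b' : ℝ}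
    (hb : b ∈ heightValues K ω) (hb' : b' ∈ heightValues K' ω) :
    ∃ f ∈ diffSurfaces K K', f ω = |b - b'| := by
  obtain ⟨α, rfl⟩ := (mem_heightValues K).1 hb
  obtain ⟨σ, rfl⟩ := (mem_heightValues K').1 hb'
  exact ⟨_, ⟨.inl α, .inr σ, Sum.inl_ne_inr, rfl⟩, rfl⟩

theorem exists_diffSurface_of_left [Finite K.faces] {ω : S2} {b d : ℝ} (hb : b ∈ heightValues K ω)
    (hd : d ∈ heightValues K ω) (h : b < d) : ∃ f ∈ diffSurfaces K K', f ω = |d - b| / 2 := by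
  obtain ⟨α, rfl⟩ := (mem_heightValues K).1 hb
  obtain ⟨σ, rfl⟩ := (mem_heightValues K).1 hd
  exact ⟨_, ⟨.inl σ, .inl α, fun e => h.ne' (by rw [Sum.inl.inj e]), rfl⟩, rfl⟩

theorem exists_diffSurface_of_right [Finite K'.faces] {ω : S2} {b d : ℝ}
    (hb : b ∈ heightValues K' ω) (hd : d ∈ heightValues K' ω) (h : b < d) :
    ∃ f ∈ diffSurfaces K K', f ω = |d - b| / 2 := by
  obtain ⟨α, rfl⟩ := (mem_heightValues K').1 hb
  obtain ⟨σ, rfl⟩ := (mem_heightValues K').1 hd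
  exact ⟨_, ⟨.inr σ, .inr α, fun e => h.ne' (by rw [Sum.inr.inj e]), rfl⟩, rfl⟩

theorem exists_diffSurface_of_pointDist [Finite K.faces] [Finite K'.faces] {k : ℕ} {ω : S2}
    {x y : ℝ × WithTop ℝ} (hx : x ∈ dgm K F k ω) (hy : y ∈ dgm K' F k ω)
    (hfin : pointDist x y ≠ ∞) :
    ∃ f ∈ diffSurfaces K K', ENNReal.ofReal (f ω) = pointDist x y := by
  have hof : ∀ {b b'}, b ∈ heightValues K ω → b' ∈ heightValues K' ω →
      ∃ f ∈ diffSurfaces K K', ENNReal.ofReal (f ω) = ENNReal.ofReal |b - b'| := fun hb hb' => by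
    obtain ⟨f, hf, he⟩ := exists_diffSurface_of_mixed hb hb'
    exact ⟨f, hf, by rw [he]⟩
  obtain ⟨b, hb, ⟨-, rfl⟩ | ⟨d, hd, -, -, rfl⟩⟩ := (mem_dgm K).1 hx <;>
    obtain ⟨b', hb', ⟨-, rfl⟩ | ⟨d', hd', -, -, rfl⟩⟩ := (mem_dgm K').1 hy
  · have : pointDist (b, ⊤) (b', ⊤) = ENNReal.ofReal |b - b'| := max_eq_left zero_le
    rw [this]
    exact hof hb hb'
  · exact absurd (max_eq_right le_top) hfin
  · exact absurd (max_eq_right le_top) hfin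
  · rcases max_choice (ENNReal.ofReal |b - b'|) (ENNReal.ofReal |d - d'|) with h | h
    · obtain ⟨f, hf, he⟩ := hof hb hb'
      exact ⟨f, hf, he.trans h.symm⟩
    · obtain ⟨f, hf, he⟩ := hof hd hd'
      exact ⟨f, hf, he.trans h.symm⟩

theorem exists_top_mem_dgm_zero [Finite K.faces] (hK : K.faces.Nonempty) (ω : S2) :
    ∃ b, (b, ⊤) ∈ dgm K F 0 ω := by
  obtain ⟨σ, hσ⟩ := hK
  have : Nonempty K.faces := ⟨⟨σ, hσ⟩⟩
  obtain ⟨α, hα⟩ := Finite.exists_min fun α : K.faces => insertion K α ω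
  obtain ⟨v, hv⟩ := K.nonempty_of_mem_faces α.2
  have hvK : {v} ∈ sublevel K ω (insertion K α ω) :=
    ⟨K.down_closed α.2 (Finset.singleton_subset_iff.2 hv) (Finset.singleton_nonempty v),
      fun w hw => by
        rw [Finset.mem_singleton.1 hw]
        exact (insertion_le_iff K α ω _).1 le_rfl v hv⟩
  have hempty : strictSublevel K ω (insertion K α ω) = ∅ := by
    rw [← entering_Iio, eq_empty_iff_forall_notMem]
    rintro τ ⟨hτ, hlt⟩
    exact (hα ⟨τ, hτ⟩).not_gt hlt
  refine ⟨insertion K α ω, (mem_dgm K).2 ⟨_, (mem_heightValues K).2 ⟨α, rfl⟩, Or.inl ⟨?_, rfl⟩⟩⟩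
  rw [multTop, hempty, persistentBetti_empty, Nat.sub_zero]
  exact (persistentBetti_zero_pos F (finite_sublevel K ω _) hvK).ne'

/-- In every direction, the bottleneck distance is the value of a difference surface. When it is
zero, the surface comes from the births of matched essential classes in degree zero. -/
theorem exists_diffSurface_eq [Finite K.faces] [Finite K'.faces] (hK : K.faces.Nonempty) {ω : S2}
    (hfin : bottleneckAt K K' F ω ≠ ∞) :
    ∃ f ∈ diffSurfaces K K', ENNReal.ofReal (f ω) = bottleneckAt K K' F ω := by
  obtain ⟨k, -, hk⟩ := Finset.exists_mem_eq_sup (Finset.range 3) ⟨0, by simp⟩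
    fun k => bottleneck (dgm K F k ω) (dgm K' F k ω)
  change bottleneckAt K K' F ω = _ at hk
  rcases bottleneck_value (dgm K F k ω) (dgm K' F k ω) with h | ⟨x, hx, y, hy, h⟩ | ⟨x, hx, h⟩ |
    ⟨y, hy, h⟩
  · have h0 : bottleneck (dgm K F 0 ω) (dgm K' F 0 ω) = 0 := by
      rw [← le_zero_iff, ← h, ← hk]
      exact Finset.le_sup (f := fun k => bottleneck (dgm K F k ω) (dgm K' F k ω)) (by simp)
    obtain ⟨b, hb⟩ := exists_top_mem_dgm_zero F hK ω
    have hb' := exists_top_mem_of_bottleneck_eq_zero h0 hb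
    obtain ⟨b₁, hb₁, ⟨-, e⟩ | ⟨d, -, -, -, e⟩⟩ := (mem_dgm K).1 hb
    · obtain ⟨b₂, hb₂, ⟨-, e'⟩ | ⟨d, -, -, -, e'⟩⟩ := (mem_dgm K').1 hb'
      · obtain ⟨f, hf, he⟩ := exists_diffSurface_of_mixed hb₁ hb₂
        refine ⟨f, hf, ?_⟩
        rw [hk, h, he, ← (Prod.mk.inj e).1, ← (Prod.mk.inj e').1]
        simp
      · exact absurd (congrArg Prod.snd e') WithTop.top_ne_coe
    · exact absurd (congrArg Prod.snd e) WithTop.top_ne_coe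
  · rw [hk, h] at hfin ⊢
    exact exists_diffSurface_of_pointDist F hx hy hfin
  · rw [hk, h] at hfin ⊢
    obtain ⟨b, hb, ⟨-, rfl⟩ | ⟨d, hd, hbd, -, rfl⟩⟩ := (mem_dgm K).1 hx
    · exact absurd rfl hfin
    · obtain ⟨f, hf, he⟩ := exists_diffSurface_of_left (K' := K') hb hd hbd
      exact ⟨f, hf, congrArg ENNReal.ofReal he⟩
  · rw [hk, h] at hfin ⊢
    obtain ⟨b, hb, ⟨-, rfl⟩ | ⟨d, hd, hbd, -, rfl⟩⟩ := (mem_dgm K').1 hy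
    · exact absurd rfl hfin
    · obtain ⟨f, hf, he⟩ := exists_diffSurface_of_right (K := K) hb hd hbd
      exact ⟨f, hf, congrArg ENNReal.ofReal he⟩

end Surfaces

end Main

end PHT

theorem mainTheorem5 (F : Type*) [Field F]
    (K K' : Geometry.SimplicialComplex ℝ PHT.E3) [Finite K.faces] [Finite K'.faces]
    (hK : K.faces.Nonempty) (hK' : K'.faces.Nonempty)
    (hfin : PHT.dInf K K' F ≠ ∞) :
    (∃ ω : PHT.S2, PHT.bottleneckAt K K' F ω = PHT.dInf K K' F) ∧
    ∀ ω : PHT.S2, PHT.bottleneckAt K K' F ω = PHT.dInf K K' F →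
      -- a local maximum of a difference surface
      (∃ f ∈ PHT.diffSurfaces K K',
        ENNReal.ofReal (f ω) = PHT.dInf K K' F ∧ IsLocalMax f ω) ∨
      -- a local maximum along an intersection curve of two difference surfaces
      (∃ f ∈ PHT.diffSurfaces K K', ∃ g ∈ PHT.diffSurfaces K K',
        ENNReal.ofReal (f ω) = PHT.dInf K K' F ∧ ENNReal.ofReal (g ω) = PHT.dInf K K' F ∧
        ω ∈ PHT.intersection f g ∧ AccPt ω (𝓟 (PHT.intersection f g)) ∧
        IsLocalMaxOn f (PHT.agreement f g) ω) ∨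
      -- a triple intersection point of three difference surfaces
      (∃ f ∈ PHT.diffSurfaces K K', ∃ g ∈ PHT.diffSurfaces K K', ∃ h ∈ PHT.diffSurfaces K K',
        ENNReal.ofReal (f ω) = PHT.dInf K K' F ∧ ENNReal.ofReal (g ω) = PHT.dInf K K' F ∧
        ENNReal.ofReal (h ω) = PHT.dInf K K' F ∧
        ω ∈ PHT.intersection f g ∧ ω ∈ PHT.intersection g h ∧ ω ∈ PHT.intersection f h) := by
  have hcont := PHT.continuous_bottleneckAt K K' F hfin
  have hle := PHT.bottleneckAt_le_dInf K K' F
  have hne : ∀ ω, PHT.bottleneckAt K K' F ω ≠ ∞ := fun ω => ne_top_of_le_ne_top hfin (hle ω)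
  constructor
  · have : Nonempty PHT.S2 := (NormedSpace.sphere_nonempty.2 zero_le_one).to_subtype
    obtain ⟨ω, -, hω⟩ := isCompact_univ.exists_isMaxOn Set.univ_nonempty hcont.continuousOn
    exact ⟨ω, le_antisymm (hle ω) (iSup_le fun ω' => hω (Set.mem_univ ω'))⟩
  intro ω hω
  -- the finite distances are treated as real numbers
  have hsel : ∀ x, ∃ f ∈ PHT.diffSurfaces K K', (PHT.bottleneckAt K K' F x).toReal = f x := by
    intro x
    obtain ⟨f, ⟨α, σ, hασ, rfl⟩, hfx⟩ := PHT.exists_diffSurface_eq F hK (hne x)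
    refine ⟨_, ⟨α, σ, hασ, rfl⟩, ?_⟩
    rw [← hfx, ENNReal.toReal_ofReal (PHT.diffFun_nonneg K K' α σ x)]
  have hval : ∀ {f : PHT.S2 → ℝ}, f ω = (PHT.bottleneckAt K K' F ω).toReal →
      ENNReal.ofReal (f ω) = PHT.dInf K K' F := fun h => by
    rw [h, ENNReal.ofReal_toReal (hne ω), hω]
  rcases PHT.selection_max_trichotomy (PHT.finite_diffSurfaces K K')
    (by rintro f ⟨α, σ, -, rfl⟩; exact PHT.continuous_diffFun K K' α σ)
    (ENNReal.continuousOn_toReal.comp_continuous hcont hne) hsel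
    (PHT.sphere_punctured_connected ω)
    (fun x => ENNReal.toReal_mono (hne ω) ((hle x).trans hω.ge)) with
    ⟨f, hf, h1, h2⟩ | ⟨f, hf, g, hg, h1, h2, h3⟩ | ⟨f, hf, g, hg, h, hh, h1, h2, h3, h4⟩
  · exact Or.inl ⟨f, hf, hval h1, h2⟩
  · exact Or.inr (Or.inl ⟨f, hf, g, hg, hval h1, hval h2, h3⟩)
  · exact Or.inr (Or.inr ⟨f, hf, g, hg, h, hh, hval h1, hval h2, hval h3, h4⟩)
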